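/- Let $p\ge 2$ and let $A_i$ be a real (or complex) $m_i\times n_i$ matrix for $i=1,\dots,p$. The rank expansion of a matrix $A$ with $n$ columns is $\tilde\sigma(k)=$ the minimum of the ranks of the matrices formed by $k$ different columns of $A$, for $1\le k\le n$. A rank expansion lower bound for $A$ is a continuous, nonnegative, nondecreasing function $\sigma$ on $[0,\infty)$ with $\sigma(k)\le\tilde\sigma(k)$ for all integers $1\le k\le n$. A function $f$ is log-log concave if $\ln f(e^u)$ is a concave function of $u\in\mathbb{R}$ (with $\ln 0=-\infty$). Let $C=\bigotimes_{i=1}^p A_i$ be the Kronecker product. (1) Let $\sigma_i$ be a concave and log-log concave rank expansion lower bound for $A_i$ with $\sigma_i(0)=0$, for each $i$. Put $d_i=\sup\{k\ge 0:\sigma_i(k)\le 1\}\in(0,\infty]$. Then $$\sigma_C(k)=\min_{1\le j\le p}\ \sigma_j\!\left(\frac{k}{\prod_{i\ne j}d_i}\right),\qquad k\ge 0,$$ with the convention $k/\infty=0$, is a concave and log-log concave rank expansion lower bound for $C$. (2) If $\sigma_i(k)=(k/k_i)^{q_i}$ with $k_i\ge 1$ and $q_i\in(0,1]$ is a rank expansion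 lower bound for $A_i$ for each $i$, then $$\left(\frac{k}{\prod_i k_i}\right)^{\min_i q_i}$$ is a concave and log-log concave rank expansion lower bound for $C$, and it equals the minimum $\sigma_C(k)$ in (1) for all real $k\ge\prod_i k_i$. (3) If $\sigma_i(k)=a_i\ln(b_ik+1)$ with $a_i,b_i>0$ is a rank expansion lower bound for $A_i$ for each $i$, then $$a\ln(bk+1),\qquad a=\min_i a_i,\qquad b=\frac{e^{1/a}-1}{\prod_{i=1}^p b_i^{-1}(e^{1/a_i}-1)},$$ is a concave and log-log concave rank expansion lower bound for $C$, and it equals the minimum $\sigma_C(k)$ in (1) for all real $k\ge\prod_i b_i^{-1}(e^{1/a_i}-1)$. -/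

import Mathlib

open scoped ENNReal

/-- The Kronecker product of a finite family of matrices. Its rows and columns are indexed by
tuples of row and column indices of the factors, and the entry at `(r, c)` is the product of
the entries of the factors. -/
def piKronecker {𝕜 ι : Type*} [CommRing 𝕜] [Fintype ι] {m n : ι → Type*}
    (A : ∀ i, Matrix (m i) (n i) 𝕜) : Matrix (∀ i, m i) (∀ i, n i) 𝕜 :=
  Matrix.of fun r c => ∏ i, A i (r i) (c i)

/-- The rank expansion of `A`: the smallest rank of a matrix formed by `k` different columns
of `A`. It is meaningful for `k` at most the number of columns. -/
noncomputable def rankExpansion {𝕜 m n : Type*} [CommRing 𝕜] (A : Matrix m n 𝕜) (k : ℕ) : ℕ :=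
  sInf {r : ℕ | ∃ f : Fin k ↪ n, (A.submatrix id f).rank = r}

/-- A rank expansion lower bound for `A`: a continuous, nonnegative, nondecreasing function on
`[0, ∞)` that is at most the rank expansion of `A` at `1, …, #columns`. Values of `σ` at
negative arguments play no role. -/
structure IsRankExpansionLowerBound {𝕜 m n : Type*} [CommRing 𝕜] [Fintype n]
    (σ : ℝ → ℝ) (A : Matrix m n 𝕜) : Prop where
  continuousOn : ContinuousOn σ (Set.Ici 0)
  nonneg : ∀ x, 0 ≤ x → 0 ≤ σ x
  monotoneOn : MonotoneOn σ (Set.Ici 0)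
  le_rankExpansion : ∀ k : ℕ, 1 ≤ k → k ≤ Fintype.card n → σ k ≤ rankExpansion A k

/-- `f` is log-log concave: `ln f` is a concave function of `u = ln x`, on the set of those `u`
for which `f (exp u)` is positive (this set has to be convex, as for any concave function that
may take the value `-∞`; it is the whole line when `f` is positive on `(0, ∞)`). -/
def LogLogConcave (f : ℝ → ℝ) : Prop :=
  ConcaveOn ℝ {u : ℝ | 0 < f (Real.exp u)} fun u => Real.log (f (Real.exp u))

/-- The pseudoinverse `f† x = sup {k ≥ 0 : f k ≤ x}` of a nondecreasing function `f` on
`[0, ∞)`, a number in `[0, ∞]`. -/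
noncomputable def pseudoinverse (f : ℝ → ℝ) (x : ℝ) : ℝ≥0∞ :=
  ⨆ k ∈ {k : ℝ | 0 ≤ k ∧ f k ≤ x}, ENNReal.ofReal k

/-- The function `k ↦ min_j σ_j (k / ∏_{i ≠ j} d_i)`, where `d_i = σ_i† 1`, for `k ≥ 0`.
The division is that of `[0, ∞]`, so `k / ∞ = 0`. -/
noncomputable def nestedBound {ι : Type*} [Fintype ι] [DecidableEq ι] (σ : ι → ℝ → ℝ)
    (k : ℝ) : ℝ :=
  ⨅ j, σ j (ENNReal.ofReal k / ∏ i ∈ Finset.univ.erase j, pseudoinverse (σ i) 1).toReal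

/-!
Scaling the argument of `σ_i` by `d_i` (the point where `σ_i` reaches `1`) gives a function with
value `1` at `1`. The minimum `τ` of these normalized functions is again concave and log-log
concave, with `τ 1 = 1`, and all factors satisfy the bound `rank ≥ τ (|S| / d_i)` for a set `S` of
columns. The nested bound is `τ (k / ∏ d_i)`, so it suffices to show that a bound with a common
shape `τ` passes to products, with the scales multiplying; by induction on the number of factors,
only the product of two matrices `A` and `B` matters (`HasColumnGrowth.kronecker`).

For two factors, a set `S` of columns is cut into fibers over the columns `x` of `A`. If `I` is an
independent set of columns of `A`, the rank of `S` is at least the sum over `x ∈ I` of the ranks of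
the fibers. Choosing `I` greedily, by decreasing size of the fiber, makes `I` contain a basis
of every level set of the fiber size (`exists_linearIndepOn_levels`). Each fiber in question has
rank at least `τ (max (l / b) 1)`, where `l` is its size and the `1` comes from the integrality of the
rank. By concavity of `τ`, the sum is minimized by functions that are `1` off a level set and
constant on it (`IsGrowthShape.le_sum_of_levels`), and for those a second use of concavity reduces
to the two extremes: fibers that all count as `1`, or fibers of equal size `l`
(`IsGrowthShape.le_two_step`). The latter give `τ l * τ (K / l) ≥ τ K`, where log-log concavity
enters as submultiplicativity on `[1, ∞)`.

If some `d_i` is infinite, the nested bound is zero. For powers and logarithms the normalized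
functions form a family that increases with its parameter on `[1, ∞)`
(`monotoneOn_mul_log_exp_one_div` for logarithms), so the nested bound is given there by the
smallest parameter; on `[0, 1]` that function is at most `1`, hence at most every nonzero rank.
-/

/-! ### Growth shapes and the optimization over level sets -/

/-- A growth shape: a nondecreasing concave function `τ` on `[0, ∞)` with `τ 0 = 0` and `τ 1 = 1`
that is submultiplicative on `[1, ∞)`. Submultiplicativity is all that the bound for Kronecker
products needs of log-log concavity. -/
structure IsGrowthShape (τ : ℝ → ℝ) : Prop where
  monotoneOn : MonotoneOn τ (Set.Ici 0)
  concaveOn : ConcaveOn ℝ (Set.Ici 0) τ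
  map_zero : τ 0 = 0
  map_one : τ 1 = 1
  submul : ∀ x y, 1 ≤ x → 1 ≤ y → τ (x * y) ≤ τ x * τ y

namespace IsGrowthShape

variable {τ : ℝ → ℝ}

theorem one_le (h : IsGrowthShape τ) {x : ℝ} (hx : 1 ≤ x) : 1 ≤ τ x := by
  rw [← h.map_one]
  exact h.monotoneOn (by simp) (by simp; linarith) hx

theorem map_max (h : IsGrowthShape τ) {x : ℝ} (hx : 0 ≤ x) : τ (max x 1) = max (τ x) 1 := by
  rw [h.monotoneOn.map_max (Set.mem_Ici.2 hx) (Set.mem_Ici.2 zero_le_one), h.map_one]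

/-- Think of `x` fibers, `y` of which have size `l` and the others size `1`, the total size being
`x + (l - 1) * y`. Moving mass so that this total is kept makes the right-hand side a concave
function of `y`; at one end (`y = 0`) it is `τ K`, at the other (`x = y = K / l`) it is
`τ l * τ (K / l)`, which is at least `τ K` by submultiplicativity. -/
theorem le_two_step (h : IsGrowthShape τ) {x y l : ℝ} (hy : 1 ≤ y) (hyx : y ≤ x) (hl : 1 ≤ l) :
    τ (x + (l - 1) * y) ≤ τ x + (τ l - 1) * τ y := by
  set K := x + (l - 1) * y with hK
  have hl0 : 0 < l := by linarith
  have hKl : y ≤ K / l := by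
    rw [le_div_iff₀ hl0]
    nlinarith
  have hz0 : 0 < K / l := by linarith
  have hK0 : 0 < K := by
    have := mul_nonneg (sub_nonneg.2 hl) (by linarith : (0 : ℝ) ≤ y)
    linarith
  -- `(x, y)` is the convex combination of `(K, 0)` and `(K / l, K / l)` with weight `θ`
  set θ := y / (K / l) with hθ
  have hθ0 : 0 ≤ θ := by positivity
  have hθ1 : θ ≤ 1 := by rw [hθ, div_le_one hz0]; exact hKl
  have hyθ : θ * (K / l) = y := by rw [hθ]; field_simp
  have hxθ : (1 - θ) * K + θ * (K / l) = x := by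
    have : θ * K = y * l := by rw [hθ]; field_simp
    rw [hyθ, sub_mul, this, hK]; ring
  have h1 := h.concaveOn.2 (x := 0) (by simp) (y := K / l) hz0.le (sub_nonneg.2 hθ1) hθ0 (by ring)
  have h2 := h.concaveOn.2 (x := K) hK0.le (y := K / l) hz0.le (sub_nonneg.2 hθ1) hθ0 (by ring)
  simp only [smul_eq_mul, h.map_zero, mul_zero, zero_add, hxθ] at h1 h2
  rw [hyθ] at h1
  have h3 := h.submul l (K / l) hl (by linarith)
  rw [mul_div_cancel₀ _ hl0.ne'] at h3
  have h4 := mul_le_mul_of_nonneg_left h3 hθ0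
  have h5 := mul_le_mul_of_nonneg_left h1 (sub_nonneg.2 (h.one_le hl))
  nlinarith

/-- The analytic core. The fibers over the points of `X` have sizes `l x`, and `I` is a set of
points that is large in every level set `{t ≤ l}`. The function `max (l / b) 1` on the
nonempty fibers is a convex combination of two-valued functions, each equal to `1` off a level
set and constant on it; by concavity of `τ` the sum over `I` is at least the corresponding
combination of the values for these, to which `le_two_step` applies. -/
theorem le_sum_of_levels (h : IsGrowthShape τ) {X : Type*} [Fintype X] (l : X → ℕ)
    {a b : ℝ} (ha : 0 < a) (hb : 0 < b) (I : Finset X) (hI : ∀ x ∈ I, 1 ≤ l x)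
    (hl : ∃ x, 1 ≤ l x)
    (hcard : ∀ t, (∃ x, t ≤ l x) → 1 ≤ t →
      1 ≤ (I.filter (t ≤ l ·)).card ∧
      τ ((Finset.univ.filter (t ≤ l ·)).card / a) ≤ (I.filter (t ≤ l ·)).card) :
    τ ((∑ x, l x : ℕ) / (a * b)) ≤ ∑ x ∈ I, τ (max (l x / b) 1) := by
  classical
  set e : ℕ → ℝ := fun t => ((Finset.univ.filter (t ≤ l ·)).card : ℝ) with he
  set i : ℕ → ℝ := fun t => ((I.filter (t ≤ l ·)).card : ℝ) with hi
  have : Nonempty X := hl.nonempty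
  obtain ⟨x₀, hx₀⟩ := Finite.exists_max l
  set L := l x₀ with hL
  have hL1 : 1 ≤ L := by
    obtain ⟨x, hx⟩ := hl
    exact hx.trans (hx₀ x)
  have hmem : ∀ t, t < L → ∃ x, t + 1 ≤ l x := fun t ht => ⟨x₀, ht⟩
  have he1 : ∀ t < L, 1 ≤ e (t + 1) := fun t ht => by
    obtain ⟨x, hx⟩ := hmem t ht
    have : 0 < (Finset.univ.filter (t + 1 ≤ l ·)).card :=
      Finset.card_pos.2 ⟨x, by simpa using hx⟩
    exact Nat.one_le_cast.2 this
  have hτi : ∀ t < L, τ (max (e (t + 1) / a) 1) ≤ i (t + 1) := fun t ht => by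
    obtain ⟨h1, h2⟩ := hcard (t + 1) (hmem t ht) (by omega)
    rw [h.map_max (div_nonneg (by linarith [he1 t ht]) ha.le)]
    exact max_le h2 (Nat.one_le_cast.2 h1)
  have hIi : i 1 = I.card := by
    simp only [hi]
    rw [Finset.filter_true_of_mem hI]
  -- increments of `t ↦ max (t / b) 1`
  set δ : ℕ → ℝ := fun t => max ((t + 1 : ℕ) / b) 1 - max (t / b) 1 with hδ
  have hδ0 : ∀ t, 0 ≤ δ t := fun t => by
    refine sub_nonneg.2 (max_le_max_right _ ?_)
    gcongr
    simp
  have htel : ∀ x, ∑ t ∈ Finset.range L, δ t * (if t + 1 ≤ l x then 1 else 0)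
      = max (l x / b) 1 - 1 := fun x => by
    have : ∀ t, (t + 1 ≤ l x) = (t ∈ Finset.range (l x)) := fun t => by simp
    simp only [this, mul_ite, mul_one, mul_zero]
    rw [Finset.sum_ite_mem, Finset.inter_eq_right.2 (Finset.range_mono (hx₀ x))]
    simp only [hδ]
    rw [Finset.sum_range_sub (fun t : ℕ => max ((t : ℝ) / b) 1)]
    simp
  set c : ℝ := ∑ t ∈ Finset.range L, δ t * e (t + 1) with hc
  have hcl : ((∑ x, l x : ℕ) : ℝ) / b ≤ e 1 + c := by
    have hc' : c = ∑ x, (max (l x / b) 1 - 1) := by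
      simp_rw [← htel]
      rw [Finset.sum_comm]
      refine Finset.sum_congr rfl fun t _ => ?_
      rw [← Finset.mul_sum]
      simp [he]
    have he' : e 1 = ∑ x, if 1 ≤ l x then 1 else 0 := by simp [he]
    rw [hc', he', ← Finset.sum_add_distrib, Nat.cast_sum, Finset.sum_div]
    refine Finset.sum_le_sum fun x _ => ?_
    split_ifs with hx
    · linarith [le_max_left ((l x : ℝ) / b) 1]
    · have : l x = 0 := by omega
      simp [this]
  have hc0 : 0 ≤ c := Finset.sum_nonneg fun t ht =>
    mul_nonneg (hδ0 t) (by linarith [he1 t (Finset.mem_range.1 ht)])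
  have hei : ∀ t, e (t + 1) ≤ e 1 := fun t => by
    simp only [he]
    exact_mod_cast Finset.card_le_card (fun x hx => by simp at hx ⊢; omega)
  have hmono : ∀ z, (e 1 + c) / a ≤ z → τ ((∑ x, l x : ℕ) / (a * b)) ≤ τ z := fun z hz => by
    have h0 : ((∑ x, l x : ℕ) : ℝ) / (a * b) ≤ z := by
      rw [mul_comm, ← div_div]
      exact le_trans (by gcongr) hz
    have h1 : 0 ≤ ((∑ x, l x : ℕ) : ℝ) / (a * b) := by positivity
    exact h.monotoneOn h1 (h1.trans h0) h0
  -- if `c = 0`, every fiber has size at most `b`, and counting nonempty fibers is enough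
  rcases hc0.eq_or_lt with hc0 | hc0
  · calc τ ((∑ x, l x : ℕ) / (a * b)) ≤ τ (max (e 1 / a) 1) :=
          hmono _ (by rw [← hc0, add_zero]; exact le_max_left _ _)
      _ ≤ i 1 := hτi 0 hL1
      _ = ∑ x ∈ I, 1 := by simp [hIi]
      _ ≤ _ := Finset.sum_le_sum fun x _ => h.one_le (le_max_right _ _)
  have htwo : ∀ t < L, τ ((∑ x, l x : ℕ) / (a * b))
      ≤ i 1 + (τ (1 + c / e (t + 1)) - 1) * i (t + 1) := fun t ht => by
    have het := he1 t ht
    have hlt : 1 ≤ 1 + c / e (t + 1) := by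
      have : 0 ≤ c / e (t + 1) := by positivity
      linarith
    refine (hmono _ ?_).trans ((h.le_two_step (x := max (e 1 / a) 1)
      (y := max (e (t + 1) / a) 1) (le_max_right _ _)
      (max_le_max_right _ (by gcongr; exact hei t)) hlt).trans ?_)
    · have h1 : c / a = c / e (t + 1) * (e (t + 1) / a) := by field_simp
      have h2 : 0 ≤ c / e (t + 1) := by positivity
      have h3 := mul_le_mul_of_nonneg_left (le_max_left (e (t + 1) / a) 1) h2
      rw [add_div, h1, add_sub_cancel_left]
      exact add_le_add (le_max_left _ _) h3
    · have := h.one_le hlt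
      exact add_le_add (hτi 0 hL1) (mul_le_mul_of_nonneg_left (hτi t ht) (by linarith))
  -- the weights of the two-step functions
  set w : ℕ → ℝ := fun t => δ t * e (t + 1) / c with hw
  have hw0 : ∀ t ∈ Finset.range L, 0 ≤ w t := fun t ht =>
    div_nonneg (mul_nonneg (hδ0 t) (by linarith [he1 t (Finset.mem_range.1 ht)])) hc0.le
  have hw1 : ∑ t ∈ Finset.range L, w t = 1 := by
    simp only [hw]
    rw [← Finset.sum_div, ← hc, div_self hc0.ne']
  have hjen : ∀ x, ∑ t ∈ Finset.range L,
      w t * (1 + (τ (1 + c / e (t + 1)) - 1) * (if t + 1 ≤ l x then 1 else 0))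
        ≤ τ (max (l x / b) 1) := fun x => by
    have hp : ∀ t ∈ Finset.range L,
        1 + c / e (t + 1) * (if t + 1 ≤ l x then 1 else 0) ∈ Set.Ici (0 : ℝ) := fun t ht => by
      have := he1 t (Finset.mem_range.1 ht)
      rw [Set.mem_Ici]
      split_ifs <;> positivity
    have hJ := h.concaveOn.le_map_sum hw0 hw1 hp
    have hsum : ∑ t ∈ Finset.range L, w t • (1 + c / e (t + 1) * (if t + 1 ≤ l x then (1:ℝ) else 0))
        = max (l x / b) 1 := by
      have : ∀ t ∈ Finset.range L, w t • (1 + c / e (t + 1) * (if t + 1 ≤ l x then (1:ℝ) else 0))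
          = w t + δ t * (if t + 1 ≤ l x then 1 else 0) := fun t ht => by
        have := he1 t (Finset.mem_range.1 ht)
        have h0 : e (t + 1) ≠ 0 := by linarith
        simp only [hw, smul_eq_mul]
        field_simp
      rw [Finset.sum_congr rfl this, Finset.sum_add_distrib, hw1, htel]
      ring
    rw [hsum] at hJ
    refine le_trans (le_of_eq (Finset.sum_congr rfl fun t _ => ?_)) hJ
    split_ifs <;> simp [h.map_one]
  calc τ ((∑ x, l x : ℕ) / (a * b))
      = ∑ t ∈ Finset.range L, w t * τ ((∑ x, l x : ℕ) / (a * b)) := by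
        rw [← Finset.sum_mul, hw1, one_mul]
    _ ≤ ∑ t ∈ Finset.range L, w t * (i 1 + (τ (1 + c / e (t + 1)) - 1) * i (t + 1)) :=
        Finset.sum_le_sum fun t ht =>
          mul_le_mul_of_nonneg_left (htwo t (Finset.mem_range.1 ht)) (hw0 t ht)
    _ = ∑ x ∈ I, ∑ t ∈ Finset.range L,
          w t * (1 + (τ (1 + c / e (t + 1)) - 1) * (if t + 1 ≤ l x then 1 else 0)) := by
        rw [Finset.sum_comm]
        refine Finset.sum_congr rfl fun t _ => ?_
        rw [← Finset.mul_sum, Finset.sum_add_distrib, ← Finset.mul_sum, hIi]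
        simp [hi]
    _ ≤ _ := Finset.sum_le_sum fun x _ => hjen x

end IsGrowthShape

/-! ### Bases adapted to level sets -/

section Span

variable {𝕜 : Type*} [Field 𝕜] {X V : Type*} [AddCommGroup V] [Module 𝕜 V]

theorem finrank_span_image_le_card (v : X → V) (S : Finset X) :
    Module.finrank 𝕜 (Submodule.span 𝕜 (v '' S)) ≤ S.card := by
  classical
  rw [← Finset.coe_image]
  exact (finrank_span_finset_le_card _).trans Finset.card_image_le

theorem finrank_span_image_mono (v : X → V) {S : Finset X} {T : Set X}
    (h : v '' T ⊆ Submodule.span 𝕜 (v '' S)) :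
    Module.finrank 𝕜 (Submodule.span 𝕜 (v '' T)) ≤
      Module.finrank 𝕜 (Submodule.span 𝕜 (v '' S)) := by
  have := FiniteDimensional.span_of_finite 𝕜 (S.finite_toSet.image v)
  exact Submodule.finrank_mono (Submodule.span_le.2 h)

theorem LinearIndepOn.card_le_finrank_span {v : X → V} {J S : Finset X}
    (hJ : LinearIndepOn 𝕜 v (J : Set X)) (h : J ⊆ S) :
    J.card ≤ Module.finrank 𝕜 (Submodule.span 𝕜 (v '' S)) := by
  classical
  have h1 := finrank_span_image_mono (𝕜 := 𝕜) v (S := S) (T := (J : Set X))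
    ((Set.image_mono (by exact_mod_cast h)).trans Submodule.subset_span)
  refine le_trans (le_of_eq ?_) h1
  have := finrank_span_eq_card (R := 𝕜) (b := fun x : (J : Set X) => v x) hJ
  rw [Set.image_eq_range]
  rw [this]; simp

theorem exists_linearIndepOn_card_ge (v : X → V) (S : Finset X) :
    ∃ J ⊆ S, LinearIndepOn 𝕜 v (J : Set X) ∧
      Module.finrank 𝕜 (Submodule.span 𝕜 (v '' S)) ≤ J.card := by
  classical
  obtain ⟨b, hb, -, hs, hi⟩ := exists_linearIndepOn_extension (K := 𝕜) (v := v)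
    (linearIndepOn_empty 𝕜 v) (Set.empty_subset (S : Set X))
  obtain ⟨J, rfl⟩ := (S.finite_toSet.subset hb).exists_finset_coe
  exact ⟨J, by exact_mod_cast hb, hi,
    (finrank_span_image_mono v hs).trans (finrank_span_image_le_card v J)⟩

/-- A basis adapted to the decreasing chain of level sets of `l`: one independent family that
contains a basis of each of them. It is built from the highest level downwards. This is the
greedy basis for the weight `l`. -/
theorem exists_linearIndepOn_levels [Fintype X] (v : X → V) (l : X → ℕ) :
    ∃ I : Finset X, LinearIndepOn 𝕜 v (I : Set X) ∧ (∀ x ∈ I, 1 ≤ l x) ∧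
      ∀ t, 1 ≤ t →
        Module.finrank 𝕜 (Submodule.span 𝕜 (v '' (Finset.univ.filter (t ≤ l ·) : Finset X))) ≤
          (I.filter (t ≤ l ·)).card := by
  classical
  obtain ⟨T, hT⟩ : ∃ T, ∀ x, l x < T :=
    ⟨Finset.univ.sup l + 1, fun x => Nat.lt_succ_of_le (Finset.le_sup (Finset.mem_univ x))⟩
  have key : ∀ j s, T ≤ s + j → ∃ I : Finset X, LinearIndepOn 𝕜 v (I : Set X) ∧
      (∀ x ∈ I, s ≤ l x) ∧ ∀ t, s ≤ t → v '' {x | t ≤ l x} ⊆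
        Submodule.span 𝕜 (v '' (I.filter (t ≤ l ·) : Finset X)) := by
    intro j
    induction j with
    | zero =>
      intro s hs
      refine ⟨∅, by simp, by simp, fun t ht => ?_⟩
      rintro _ ⟨x, hx, rfl⟩
      have := hT x
      simp only [Set.mem_ofPred_eq] at hx
      omega
    | succ j ih =>
      intro s hs
      obtain ⟨I, hI, hIs, hIt⟩ := ih (s + 1) (by omega)
      obtain ⟨b, hb, hIb, hspan, hbi⟩ := exists_linearIndepOn_extension (K := 𝕜) (v := v) hI
        (t := {x | s ≤ l x}) (fun x hx => by have := hIs x hx; simp; omega)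
      obtain ⟨J, rfl⟩ := b.toFinite.exists_finset_coe
      refine ⟨J, hbi, fun x hx => hb hx, fun t ht => ?_⟩
      rcases ht.eq_or_lt with rfl | ht
      · have : J.filter (s ≤ l ·) = J := Finset.filter_true_of_mem fun x hx => hb hx
        rwa [this]
      · refine (hIt t ht).trans (Submodule.span_mono (Set.image_mono ?_))
        exact_mod_cast Finset.filter_subset_filter _ (by exact_mod_cast hIb)
  obtain ⟨I, hI, hI1, hIt⟩ := key T 1 (by omega)
  refine ⟨I, hI, hI1, fun t ht => ?_⟩
  refine (finrank_span_image_mono v ?_).trans (finrank_span_image_le_card v _)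
  simpa using hIt t ht

end Span

/-! ### The bound for Kronecker products -/

section Kronecker

variable {𝕜 : Type*} [Field 𝕜] {M N P X Y Z : Type*}

/-- Every nonempty set `S` of columns of `A` has rank at least `1` and at least
`τ (|S| / d)`. Recording the bound `1` separately uses that ranks are integers: it remains
available for the sets with `|S| < d`, where `τ (|S| / d)` may be less than `1`. -/
def HasColumnGrowth (τ : ℝ → ℝ) (d : ℝ) (A : Matrix M X 𝕜) : Prop :=
  ∀ S : Finset X, S.Nonempty →
    1 ≤ Module.finrank 𝕜 (Submodule.span 𝕜 (A.col '' S)) ∧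
    τ (S.card / d) ≤ Module.finrank 𝕜 (Submodule.span 𝕜 (A.col '' S))

/-- The products of independent columns `x ∈ I` of `A` with, for each such `x`, an independent
family of columns of `B` that may depend on `x`, are independent. -/
theorem linearIndepOn_col_of_fibers {A : Matrix M X 𝕜} {B : Matrix N Y 𝕜} {C : Matrix P Z 𝕜}
    {π : Z → X} {ρ : Z → Y} {row : M → N → P}
    (hC : ∀ r s z, C (row r s) z = A r (π z) * B s (ρ z)) {J : Finset Z} {I : Finset X}
    (hI : LinearIndepOn 𝕜 A.col (I : Set X)) (hJI : ∀ z ∈ J, π z ∈ I)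
    [DecidableEq X]
    (hJ : ∀ x ∈ I, LinearIndepOn 𝕜 (fun z => B.col (ρ z)) (J.filter (π · = x) : Finset Z)) :
    LinearIndepOn 𝕜 C.col (J : Set Z) := by
  rw [linearIndepOn_finset_iff] at hI ⊢
  intro f hf z hz
  have h1 : ∀ s, ∑ x ∈ I, (∑ z ∈ J with π z = x, f z * B s (ρ z)) • A.col x = 0 := by
    intro s
    ext r
    have := congrFun hf (row r s)
    simp only [Finset.sum_apply, Pi.smul_apply, Matrix.col_apply, smul_eq_mul, hC,
      Pi.zero_apply] at this ⊢
    rw [← this, ← Finset.sum_fiberwise_of_maps_to hJI]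
    refine Finset.sum_congr rfl fun x _ => ?_
    rw [Finset.sum_mul]
    refine Finset.sum_congr rfl fun z hz => ?_
    rw [(Finset.mem_filter.1 hz).2]
    ring
  have h2 := linearIndepOn_finset_iff.1 (hJ (π z) (hJI z hz)) f (by
    ext s
    have := hI _ (h1 s) (π z) (hJI z hz)
    simpa [Finset.sum_apply, smul_eq_mul] using this)
  exact h2 z (by simpa using hz)

/-- The bound for two factors. The columns of `C` are the products of the columns `π z` of `A` and
`ρ z` of `B`. For a set `S` of columns, let `l x` be the size of its fiber over `x`; with `I`
a basis of columns of `A` adapted to the level sets of `l`, the rank of `S` is at least the sum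
over `x ∈ I` of the ranks of the fibers, to which `IsGrowthShape.le_sum_of_levels` applies. -/
theorem HasColumnGrowth.kronecker {τ : ℝ → ℝ} (hτ : IsGrowthShape τ) {a b : ℝ} (ha : 0 < a)
    (hb : 0 < b) [Fintype X] {A : Matrix M X 𝕜} {B : Matrix N Y 𝕜} {C : Matrix P Z 𝕜}
    {π : Z → X} {ρ : Z → Y} (hπρ : ∀ z z', π z = π z' → ρ z = ρ z' → z = z')
    {row : M → N → P} (hC : ∀ r s z, C (row r s) z = A r (π z) * B s (ρ z))
    (hA : HasColumnGrowth τ a A) (hB : HasColumnGrowth τ b B) :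
    HasColumnGrowth τ (a * b) C := by
  classical
  intro S hS
  set F : X → Finset Z := fun x => S.filter (π · = x) with hF
  have hBF : ∀ x, (F x).Nonempty →
      1 ≤ Module.finrank 𝕜 (Submodule.span 𝕜 ((fun z => B.col (ρ z)) '' F x)) ∧
      τ ((F x).card / b) ≤
        Module.finrank 𝕜 (Submodule.span 𝕜 ((fun z => B.col (ρ z)) '' F x)) := by
    intro x hx
    have h := hB ((F x).image ρ) (hx.image ρ)
    rw [Finset.card_image_of_injOn (by
      intro z hz z' hz' h
      simp [hF] at hz hz'
      exact hπρ _ _ (hz.2.trans hz'.2.symm) h), Finset.coe_image, Set.image_image] at h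
    exact h
  obtain ⟨I, hI, hI1, hIt⟩ := exists_linearIndepOn_levels (𝕜 := 𝕜) A.col fun x => (F x).card
  choose J hJF hJi hJc using fun x =>
    exists_linearIndepOn_card_ge (𝕜 := 𝕜) (fun z => B.col (ρ z)) (F x)
  have hJπ : ∀ x, ∀ z ∈ J x, π z = x := fun x z hz => by
    have := hJF x hz
    simp [hF] at this
    exact this.2
  have hlevel : ∀ t, (∃ x, t ≤ (F x).card) → 1 ≤ t →
      1 ≤ (I.filter (fun x => t ≤ (F x).card)).card ∧
      τ ((Finset.univ.filter (fun x => t ≤ (F x).card)).card / a) ≤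
        (I.filter (fun x => t ≤ (F x).card)).card := by
    rintro t ⟨x, hx⟩ ht
    obtain ⟨h1, h2⟩ := hA (Finset.univ.filter (fun x => t ≤ (F x).card)) ⟨x, by simpa using hx⟩
    exact ⟨h1.trans (hIt t ht), h2.trans (by exact_mod_cast hIt t ht)⟩
  obtain ⟨z₀, hz₀⟩ := hS
  have hx₀ : 1 ≤ (F (π z₀)).card := Finset.card_pos.2 ⟨z₀, by simp [hF, hz₀]⟩
  have hmain := hτ.le_sum_of_levels (fun x => (F x).card) ha hb I hI1 ⟨_, hx₀⟩ hlevel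
  have hcard : ∑ x, (F x).card = S.card :=
    (Finset.card_eq_sum_card_fiberwise (fun z _ => Finset.mem_univ (π z))).symm
  rw [hcard] at hmain
  have hmem : ∀ z, z ∈ I.biUnion J ↔ π z ∈ I ∧ z ∈ J (π z) := fun z => by
    rw [Finset.mem_biUnion]
    constructor
    · rintro ⟨x, hx, hz⟩
      rw [hJπ x z hz]
      exact ⟨hx, hz⟩
    · exact fun h => ⟨_, h⟩
  have hind : LinearIndepOn 𝕜 C.col (I.biUnion J : Set Z) := by
    refine linearIndepOn_col_of_fibers hC hI (fun z hz => ((hmem z).1 hz).1) fun x hx => ?_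
    refine (hJi x).mono ?_
    intro z hz
    simp only [Finset.coe_filter, Set.mem_ofPred_eq, hmem] at hz
    have := hz.1.2
    rwa [hz.2] at this
  have hle := hind.card_le_finrank_span (S := S) (Finset.biUnion_subset.2 fun x _ =>
    (hJF x).trans (Finset.filter_subset _ _))
  rw [Finset.card_biUnion (fun x _ y _ hxy => Finset.disjoint_left.2 fun z hz hz' =>
    hxy ((hJπ x z hz).symm.trans (hJπ y z hz')))] at hle
  have hJ1 : ∀ x ∈ I, τ (max ((F x).card / b) 1) ≤ (J x).card := fun x hx => by
    obtain ⟨h1, h2⟩ := hBF x (Finset.card_pos.1 (hI1 x hx))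
    rw [hτ.map_max (by positivity)]
    refine max_le (h2.trans (by exact_mod_cast hJc x)) ?_
    exact_mod_cast h1.trans (hJc x)
  constructor
  · refine le_trans ?_ hle
    obtain ⟨x, hx⟩ := Finset.card_pos.1 (hlevel 1 ⟨_, hx₀⟩ le_rfl).1
    have hxI := (Finset.mem_filter.1 hx).1
    exact ((hBF x (Finset.card_pos.1 (hI1 x hxI))).1.trans (hJc x)).trans
      (Finset.single_le_sum (f := fun x => (J x).card) (fun _ _ => Nat.zero_le _) hxI)
  · calc _ ≤ _ := hmain
      _ ≤ ∑ x ∈ I, ((J x).card : ℝ) := Finset.sum_le_sum hJ1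
      _ ≤ _ := by exact_mod_cast hle

/-- The bound for `p` factors with a common shape `τ`. Since `τ 1 = 1`, it starts from the
empty product, a single nonzero column. -/
theorem HasColumnGrowth.piKronecker {τ : ℝ → ℝ} (hτ : IsGrowthShape τ) :
    ∀ {p : ℕ} {m n : Fin p → ℕ} {A : ∀ i, Matrix (Fin (m i)) (Fin (n i)) 𝕜} {d : Fin p → ℝ},
      (∀ i, 0 < d i) → (∀ i, HasColumnGrowth τ (d i) (A i)) →
      HasColumnGrowth τ (∏ i, d i) (piKronecker A) := by
  intro p
  induction p with
  | zero =>
    intro m n A d hd hA S hS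
    have h1 : 1 ≤ Module.finrank 𝕜 (Submodule.span 𝕜 ((_root_.piKronecker A).col '' S)) := by
      obtain ⟨z, hz⟩ := hS
      have : LinearIndepOn 𝕜 (_root_.piKronecker A).col (({z} : Finset _) : Set _) := by
        rw [Finset.coe_singleton, linearIndepOn_singleton_iff]
        intro h
        have := congrFun h (fun i => i.elim0)
        simp [_root_.piKronecker] at this
      exact this.card_le_finrank_span (Finset.singleton_subset_iff.2 hz)
    refine ⟨h1, ?_⟩
    have hc : S.card = 1 := le_antisymm (Finset.card_le_one_of_subsingleton S) hS.card_pos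
    rw [hc]
    simp only [Finset.univ_eq_empty, Finset.prod_empty, Nat.cast_one, div_one, hτ.map_one]
    exact_mod_cast h1
  | succ p ih =>
    intro m n A d hd hA
    rw [Fin.prod_univ_succ]
    refine HasColumnGrowth.kronecker hτ (hd 0) (Finset.prod_pos fun i _ => hd i.succ)
      (A := A 0) (B := _root_.piKronecker fun i : Fin p => A i.succ)
      (π := fun z => z 0) (ρ := fun z i => z i.succ) (row := fun r s => Fin.cons r s)
      ?_ ?_ (hA 0) (ih (fun i => hd i.succ) fun i => hA i.succ)
    · intro z z' h0 h1
      funext i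
      refine Fin.cases h0 (fun i => congrFun h1 i) i
    · intro r s z
      simp [_root_.piKronecker, Fin.prod_univ_succ]

end Kronecker

/-! ### The rank expansion in terms of spans of columns -/

section RankExpansion

variable {𝕜 : Type*} [Field 𝕜] {M X : Type*}

theorem rank_submatrix_eq_finrank_span {k : ℕ} (A : Matrix M X 𝕜) (f : Fin k ↪ X) :
    (A.submatrix id f).rank =
      Module.finrank 𝕜 (Submodule.span 𝕜 (A.col '' (Finset.univ.map f : Finset X))) := by
  rw [Matrix.rank_eq_finrank_span_cols]
  have : Set.range (A.submatrix id f).col = A.col '' (Finset.univ.map f : Finset X) := by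
    rw [Finset.coe_map, Finset.coe_univ, Set.image_univ, ← Set.range_comp]
    rfl
  rw [this]

theorem le_rankExpansion_iff [Fintype X] (σ : ℝ → ℝ) (A : Matrix M X 𝕜) :
    (∀ k : ℕ, 1 ≤ k → k ≤ Fintype.card X → σ k ≤ rankExpansion A k) ↔
      ∀ S : Finset X, S.Nonempty →
        σ S.card ≤ Module.finrank 𝕜 (Submodule.span 𝕜 (A.col '' S)) := by
  constructor
  · intro h S hS
    refine (h S.card hS.card_pos S.card_le_univ).trans ?_
    norm_cast
    let f : Fin S.card ↪ X := S.equivFin.symm.toEmbedding.trans (Function.Embedding.subtype _)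
    have hf : Finset.univ.map f = S := by
      ext x
      simp only [Finset.mem_map, Finset.mem_univ, true_and]
      constructor
      · rintro ⟨i, rfl⟩
        exact (S.equivFin.symm i).2
      · intro hx
        exact ⟨S.equivFin ⟨x, hx⟩, by simp [f]⟩
    have := rank_submatrix_eq_finrank_span A f
    rw [hf] at this
    exact Nat.sInf_le ⟨f, this⟩
  · intro h k hk hkc
    have hne : {r : ℕ | ∃ f : Fin k ↪ X, (A.submatrix id f).rank = r}.Nonempty := by
      obtain ⟨f⟩ := Function.Embedding.nonempty_of_card_le (α := Fin k) (β := X)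
        (by simpa using hkc)
      exact ⟨_, f, rfl⟩
    obtain ⟨f, hf⟩ := Nat.sInf_mem hne
    have := h (Finset.univ.map f) (by
      rw [Finset.map_nonempty]; exact ⟨⟨0, hk⟩, Finset.mem_univ _⟩)
    rw [← rank_submatrix_eq_finrank_span, hf] at this
    simpa [rankExpansion] using this

end RankExpansion

/-! ### Log-log concavity and minima of concave functions -/

section LogLog

theorem logLogConcave_iff {f : ℝ → ℝ} (hf : ∀ x, 0 < x → 0 < f x) :
    LogLogConcave f ↔ ConcaveOn ℝ Set.univ fun u => Real.log (f (Real.exp u)) := by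
  have : {u : ℝ | 0 < f (Real.exp u)} = Set.univ :=
    Set.eq_univ_of_forall fun u => hf _ (Real.exp_pos u)
  rw [LogLogConcave, this]

theorem LogLogConcave.congr {f g : ℝ → ℝ} (hf : LogLogConcave f)
    (h : ∀ x, 0 < x → f x = g x) : LogLogConcave g := by
  have : ∀ u, g (Real.exp u) = f (Real.exp u) := fun u => (h _ (Real.exp_pos u)).symm
  simpa only [LogLogConcave, this] using hf

theorem LogLogConcave.comp_const_mul {f : ℝ → ℝ} (hf : LogLogConcave f) {c : ℝ} (hc : 0 < c) :
    LogLogConcave fun x => f (c * x) := by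
  have := ConcaveOn.translate_right hf (Real.log c)
  simpa [LogLogConcave, Function.comp_def, Real.exp_add, Real.exp_log hc, Set.preimage] using this

theorem LogLogConcave.const_mul {f : ℝ → ℝ} (hf : LogLogConcave f) {c : ℝ} (hc : 0 < c) :
    LogLogConcave fun x => c * f x := by
  have h1 : {u : ℝ | 0 < c * f (Real.exp u)} = {u : ℝ | 0 < f (Real.exp u)} := by
    simp [hc]
  rw [LogLogConcave, h1]
  have hf' : ConcaveOn ℝ {u : ℝ | 0 < f (Real.exp u)} fun u => Real.log (f (Real.exp u)) := hf
  refine (hf'.add_const (Real.log c)).congr fun u hu => ?_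
  have hu : 0 < f (Real.exp u) := hu
  simp [Real.log_mul hc.ne' hu.ne', add_comm]

theorem concaveOn_comp_const_mul {f : ℝ → ℝ} (hf : ConcaveOn ℝ (Set.Ici 0) f) {c : ℝ}
    (hc : 0 ≤ c) : ConcaveOn ℝ (Set.Ici 0) fun x => f (c * x) := by
  refine ⟨convex_Ici 0, fun x hx y hy s t hs ht hst => ?_⟩
  have := hf.2 (x := c * x) (mul_nonneg hc hx) (y := c * y) (mul_nonneg hc hy) hs ht hst
  refine this.trans (le_of_eq ?_)
  congr 1
  simp only [smul_eq_mul]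
  ring

theorem concaveOn_ciInf {ι : Type*} [Finite ι] [Nonempty ι] {s : Set ℝ} {f : ι → ℝ → ℝ}
    (hf : ∀ j, ConcaveOn ℝ s (f j)) : ConcaveOn ℝ s fun x => ⨅ j, f j x := by
  obtain ⟨j₀⟩ := ‹Nonempty ι›
  have : Nonempty ι := ⟨j₀⟩
  refine ⟨(hf j₀).1, fun x hx y hy a b ha hb hab => le_ciInf fun j => ?_⟩
  refine le_trans ?_ ((hf j).2 hx hy ha hb hab)
  gcongr <;> exact ciInf_le (Set.finite_range _).bddBelow j

theorem ciInf_pos_of_finite {ι : Type*} [Finite ι] [Nonempty ι] {f : ι → ℝ} (h : ∀ j, 0 < f j) :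
    0 < ⨅ j, f j := by
  obtain ⟨j, hj⟩ := exists_eq_ciInf_of_finite (f := f)
  exact hj ▸ h j

theorem map_ciInf_of_monotoneOn {ι : Type*} [Finite ι] [Nonempty ι] {s : Set ℝ} {g : ℝ → ℝ}
    (hg : MonotoneOn g s) {f : ι → ℝ} (hf : ∀ j, f j ∈ s) : g (⨅ j, f j) = ⨅ j, g (f j) := by
  obtain ⟨j, hj⟩ := exists_eq_ciInf_of_finite (f := f)
  rw [← hj]
  refine le_antisymm (le_ciInf fun i => hg (hf j) (hf i) ?_)
    (ciInf_le (Set.finite_range fun i => g (f i)).bddBelow j)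
  exact hj ▸ ciInf_le (Set.finite_range f).bddBelow i

end LogLog

/-! ### Normalized growth functions -/

/-- A continuous, nondecreasing, concave and log-log concave function on `[0, ∞)` with value `0`
at `0`, scaled to have the value `1` at `1`. The class is closed under finite minima. -/
structure IsNormalizedGrowth (τ : ℝ → ℝ) : Prop where
  continuousOn : ContinuousOn τ (Set.Ici 0)
  monotoneOn : MonotoneOn τ (Set.Ici 0)
  concaveOn : ConcaveOn ℝ (Set.Ici 0) τ
  logLogConcave : LogLogConcave τ
  map_zero : τ 0 = 0
  map_one : τ 1 = 1

namespace IsNormalizedGrowth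

variable {τ : ℝ → ℝ}

theorem pos (h : IsNormalizedGrowth τ) {x : ℝ} (hx : 0 < x) : 0 < τ x := by
  rcases le_total 1 x with h1 | h1
  · have := h.monotoneOn (Set.mem_Ici.2 zero_le_one) (Set.mem_Ici.2 hx.le) h1
    rw [h.map_one] at this
    linarith
  · have := h.concaveOn.2 (x := 0) (by simp) (y := 1) (by simp) (sub_nonneg.2 h1) hx.le (by ring)
    simp only [smul_eq_mul, h.map_zero, h.map_one, mul_zero, zero_add, mul_one] at this
    linarith

theorem isGrowthShape (h : IsNormalizedGrowth τ) : IsGrowthShape τ where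
  monotoneOn := h.monotoneOn
  concaveOn := h.concaveOn
  map_zero := h.map_zero
  map_one := h.map_one
  -- in logarithmic coordinates submultiplicativity is subadditivity on `[0, ∞)`
  submul x y hx hy := by
    have hG := (logLogConcave_iff fun x hx => h.pos hx).1 h.logLogConcave
    have hx0 : 0 < x := by linarith
    have hy0 : 0 < y := by linarith
    have hu := Real.log_nonneg hx
    have hv := Real.log_nonneg hy
    rcases (add_nonneg hu hv).eq_or_lt with h0 | h0
    · have : x = 1 := by
        rw [← Real.exp_log hx0, show Real.log x = 0 by linarith, Real.exp_zero]
      rw [this, h.map_one, one_mul, one_mul]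
    -- a concave function vanishing at `0` is subadditive on the half line
    have key : ∀ u v, 0 ≤ u → 0 ≤ v → 0 < u + v →
        u / (u + v) * Real.log (τ (Real.exp (u + v))) ≤ Real.log (τ (Real.exp u)) := by
      intro u v hu hv huv
      have := hG.2 (Set.mem_univ 0) (Set.mem_univ (u + v))
        (show 0 ≤ v / (u + v) by positivity) (show 0 ≤ u / (u + v) by positivity)
        (by field_simp; ring)
      simp only [smul_eq_mul, Real.exp_zero, h.map_one, Real.log_one, mul_zero, zero_add] at this
      rwa [div_mul_cancel₀ _ huv.ne'] at this
    have h1 := key _ _ hu hv h0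
    have h2 := key _ _ hv hu (by linarith)
    rw [add_comm (Real.log y)] at h2
    rw [Real.exp_add, Real.exp_log hx0, Real.exp_log hy0] at h1 h2
    have h3 : Real.log (τ (x * y)) ≤ Real.log (τ x * τ y) := by
      rw [Real.log_mul (h.pos hx0).ne' (h.pos hy0).ne']
      refine le_trans (le_of_eq ?_) (add_le_add h1 h2)
      field_simp
    exact (Real.log_le_log_iff (h.pos (by positivity))
      (mul_pos (h.pos hx0) (h.pos hy0))).1 h3

theorem ciInf {ι : Type*} [Fintype ι] [Nonempty ι] {τ : ι → ℝ → ℝ}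
    (h : ∀ j, IsNormalizedGrowth (τ j)) : IsNormalizedGrowth fun x => ⨅ j, τ j x where
  continuousOn := by
    have : (fun x => ⨅ j, τ j x) = fun x => Finset.univ.inf' Finset.univ_nonempty fun j => τ j x :=
      funext fun x => (Finset.inf'_univ_eq_ciInf _).symm
    rw [this]
    exact ContinuousOn.finset_inf'_apply _ fun j _ => (h j).continuousOn
  monotoneOn x hx y hy hxy :=
    ciInf_mono (Set.finite_range _).bddBelow fun j => (h j).monotoneOn hx hy hxy
  concaveOn := concaveOn_ciInf fun j => (h j).concaveOn
  logLogConcave := by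
    rw [logLogConcave_iff fun x hx => ciInf_pos_of_finite fun j => (h j).pos hx]
    have : (fun u => Real.log (⨅ j, τ j (Real.exp u))) =
        fun u => ⨅ j, Real.log (τ j (Real.exp u)) := funext fun u =>
      map_ciInf_of_monotoneOn Real.strictMonoOn_log.monotoneOn fun j => (h j).pos (Real.exp_pos u)
    rw [this]
    exact concaveOn_ciInf fun j =>
      (logLogConcave_iff fun x hx => (h j).pos hx).1 (h j).logLogConcave
  map_zero := by simp [(h _).map_zero]
  map_one := by simp [(h _).map_one]

theorem isRankExpansionLowerBound {𝕜 : Type*} [Field 𝕜] {M X : Type*} [Fintype X]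
    (h : IsNormalizedGrowth τ) {d : ℝ} (hd : 0 < d) {A : Matrix M X 𝕜}
    (hA : HasColumnGrowth τ d A) : IsRankExpansionLowerBound (fun x => τ (x / d)) A where
  continuousOn := h.continuousOn.comp (by fun_prop) fun x hx => div_nonneg hx hd.le
  nonneg x hx := by
    rw [← h.map_zero]
    exact h.monotoneOn (by simp) (div_nonneg hx hd.le) (div_nonneg hx hd.le)
  monotoneOn x hx y hy hxy :=
    h.monotoneOn (div_nonneg hx hd.le) (div_nonneg hy hd.le) (by gcongr)
  le_rankExpansion :=
    (le_rankExpansion_iff (fun x => τ (x / d)) A).2 fun S hS => (hA S hS).2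

end IsNormalizedGrowth

/-! ### The pseudoinverse at `1` -/

section Pseudoinverse

variable {σ : ℝ → ℝ}

theorem pseudoinverse_one_eq {d : ℝ} (hd : 0 < d) (h1 : σ d = 1) (h : ∀ x, d < x → 1 < σ x) :
    pseudoinverse σ 1 = ENNReal.ofReal d := by
  refine le_antisymm (iSup₂_le fun k hk => ENNReal.ofReal_le_ofReal ?_)
    (le_iSup₂_of_le d ⟨hd.le, h1.le⟩ le_rfl)
  by_contra! hlt
  exact absurd hk.2 (not_le.2 (h k hlt))

theorem pseudoinverse_one_ne_zero (hc : ContinuousOn σ (Set.Ici 0)) (h0 : σ 0 = 0) :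
    pseudoinverse σ 1 ≠ 0 := by
  have h1 : ∀ᶠ x in nhdsWithin 0 (Set.Ioi 0), σ x < 1 := by
    have := (hc 0 (by simp)).mono_left (nhdsWithin_mono _ Set.Ioi_subset_Ici_self)
    exact this.eventually_lt_const (by rw [h0]; exact zero_lt_one)
  obtain ⟨x, hx, hx0⟩ := (h1.and self_mem_nhdsWithin).exists
  have hx0 : 0 < x := hx0
  refine ne_of_gt (lt_of_lt_of_le (ENNReal.ofReal_pos.2 hx0) ?_)
  exact le_iSup₂_of_le (f := fun k (_ : k ∈ {k : ℝ | 0 ≤ k ∧ σ k ≤ 1}) => ENNReal.ofReal k)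
    x ⟨hx0.le, hx.le⟩ le_rfl

/-- If `d = σ† 1` is finite, it is attained, and `σ d = 1`: it is the largest point of the level
set `{σ = 1}`, which the intermediate value theorem provides. -/
theorem exists_pseudoinverse_one_eq (hc : ContinuousOn σ (Set.Ici 0))
    (hm : MonotoneOn σ (Set.Ici 0)) (h0 : σ 0 = 0) (htop : pseudoinverse σ 1 ≠ ⊤) :
    ∃ d, 0 < d ∧ σ d = 1 ∧ pseudoinverse σ 1 = ENNReal.ofReal d := by
  obtain ⟨x₁, hx₁, hσ₁⟩ : ∃ x, 0 ≤ x ∧ 1 < σ x := by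
    by_contra! hle
    refine htop (ENNReal.eq_top_of_forall_nnreal_le fun r => ?_)
    rw [← ENNReal.ofReal_coe_nnreal]
    exact le_iSup₂_of_le (f := fun k (_ : k ∈ {k : ℝ | 0 ≤ k ∧ σ k ≤ 1}) => ENNReal.ofReal k)
      (r : ℝ) ⟨r.2, hle r r.2⟩ le_rfl
  have hsub : Set.Icc 0 x₁ ⊆ Set.Ici 0 := fun x hx => hx.1
  have hcomp : IsCompact (Set.Icc 0 x₁ ∩ σ ⁻¹' {1}) :=
    isCompact_Icc.of_isClosed_subset
      ((hc.mono hsub).preimage_isClosed_of_isClosed isClosed_Icc isClosed_singleton)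
      Set.inter_subset_left
  have hivt : ∀ z, 0 ≤ z → z ≤ x₁ → σ z ≤ 1 → ∃ y, z ≤ y ∧ y ≤ x₁ ∧ σ y = 1 := fun z hz hz1 hσ => by
    obtain ⟨y, hy, hy1⟩ := intermediate_value_Icc hz1
      (hc.mono fun x hx => hz.trans hx.1) ⟨hσ, hσ₁.le⟩
    exact ⟨y, hy.1, hy.2, hy1⟩
  have hne : (Set.Icc 0 x₁ ∩ σ ⁻¹' {1}).Nonempty := by
    obtain ⟨y, hy⟩ := hivt 0 le_rfl hx₁ (by rw [h0]; exact zero_le_one)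
    exact ⟨y, ⟨hy.1, hy.2.1⟩, hy.2.2⟩
  obtain ⟨d, ⟨⟨hd0, hd1⟩, hσd⟩, hmax⟩ := hcomp.exists_isGreatest hne
  have hσd : σ d = 1 := hσd
  have hdpos : 0 < d := hd0.lt_of_ne fun h => by
    rw [← h, h0] at hσd
    exact zero_ne_one hσd
  refine ⟨d, hdpos, hσd, pseudoinverse_one_eq hdpos hσd fun x hx => ?_⟩
  by_contra! hle
  have hx0 : 0 ≤ x := hd0.trans hx.le
  have hxx₁ : x ≤ x₁ := by
    by_contra! hlt
    linarith [hm hx₁ hx0 hlt.le]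
  obtain ⟨y, hy, hyx, hy1⟩ := hivt x hx0 hxx₁ hle
  linarith [hmax ⟨⟨hx0.trans hy, hyx⟩, hy1⟩]

end Pseudoinverse

/-! ### The nested bound -/

section NestedBound

variable {ι : Type*} [Fintype ι] [DecidableEq ι] {σ : ι → ℝ → ℝ}

/-- With finite `d_i`, the nested bound is the minimum of the normalized functions
`x ↦ σ_j (d_j * x)`, rescaled by the product of the `d_i`. -/
theorem nestedBound_eq {d : ι → ℝ} (hd : ∀ i, 0 < d i)
    (hσ : ∀ i, pseudoinverse (σ i) 1 = ENNReal.ofReal (d i)) {x : ℝ} (hx : 0 ≤ x) :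
    nestedBound σ x = ⨅ j, σ j (d j * (x / ∏ i, d i)) := by
  unfold nestedBound
  congr 1
  funext j
  have hp : 0 < ∏ i ∈ Finset.univ.erase j, d i := Finset.prod_pos fun i _ => hd i
  rw [Finset.prod_congr rfl fun i _ => hσ i, ← ENNReal.ofReal_prod_of_nonneg fun i _ => (hd i).le,
    ← ENNReal.ofReal_div_of_pos hp, ENNReal.toReal_ofReal (by positivity),
    ← Finset.mul_prod_erase _ _ (Finset.mem_univ j)]
  congr 1
  have := (hd j).ne'
  field_simp

/-- If some `d_i` is infinite, every other `σ_j` is evaluated at `k / ∞ = 0`, so that the minimum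
vanishes. -/
theorem nestedBound_eq_zero [Nontrivial ι] (hnn : ∀ i x, 0 ≤ x → 0 ≤ σ i x) (h0 : ∀ i, σ i 0 = 0)
    (hne : ∀ i, pseudoinverse (σ i) 1 ≠ 0) {i : ι} (hi : pseudoinverse (σ i) 1 = ⊤) (x : ℝ) :
    nestedBound σ x = 0 := by
  obtain ⟨j, hj⟩ := exists_ne i
  have hprod : ∏ k ∈ Finset.univ.erase j, pseudoinverse (σ k) 1 = ⊤ := by
    rw [← Finset.mul_prod_erase _ _ (Finset.mem_erase.2 ⟨hj.symm, Finset.mem_univ i⟩), hi]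
    exact ENNReal.top_mul (Finset.prod_ne_zero_iff.2 fun k _ => hne k)
  refine le_antisymm ?_ (le_ciInf fun k => hnn k _ ENNReal.toReal_nonneg)
  refine (ciInf_le (Set.finite_range _).bddBelow j).trans (le_of_eq ?_)
  rw [hprod, ENNReal.div_top, ENNReal.toReal_zero, h0]

end NestedBound

/-! ### Lower bounds for the product -/

section Product

variable {𝕜 : Type*} [Field 𝕜] {p : ℕ} [Nonempty (Fin p)] {m n : Fin p → ℕ}
  {A : ∀ i, Matrix (Fin (m i)) (Fin (n i)) 𝕜} {σ : Fin p → ℝ → ℝ} {d : Fin p → ℝ}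

theorem isNormalizedGrowth_comp_const_mul {M X : Type*} [Fintype X] {A : Matrix M X 𝕜}
    {σ : ℝ → ℝ} (hσ : IsRankExpansionLowerBound σ A) (hc : ConcaveOn ℝ (Set.Ici 0) σ)
    (hl : LogLogConcave σ) (h0 : σ 0 = 0) {d : ℝ} (hd : 0 < d) (h1 : σ d = 1) :
    IsNormalizedGrowth fun x => σ (d * x) where
  continuousOn := hσ.continuousOn.comp (by fun_prop) fun x hx => mul_nonneg hd.le hx
  monotoneOn x hx y hy hxy :=
    hσ.monotoneOn (mul_nonneg hd.le hx) (mul_nonneg hd.le hy) (by gcongr)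
  concaveOn := concaveOn_comp_const_mul hc hd.le
  logLogConcave := hl.comp_const_mul hd
  map_zero := by simp [h0]
  map_one := by simp [h1]

/-- The minimum of the normalized functions is below each of them, hence is a shape that all the
factors have in common. -/
theorem hasColumnGrowth_piKronecker (hσ : ∀ i, IsRankExpansionLowerBound (σ i) (A i))
    (hd : ∀ i, 0 < d i) (hτ : ∀ i, IsNormalizedGrowth fun x => σ i (d i * x)) :
    HasColumnGrowth (fun x => ⨅ j, σ j (d j * x)) (∏ i, d i) (piKronecker A) := by
  refine HasColumnGrowth.piKronecker (IsNormalizedGrowth.ciInf hτ).isGrowthShape hd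
    fun i S hS => ?_
  have hS0 : 0 < (S.card : ℝ) := by exact_mod_cast hS.card_pos
  have hle := (le_rankExpansion_iff _ _).1 (hσ i).le_rankExpansion S hS
  have heq : d i * (S.card / d i) = S.card := mul_div_cancel₀ _ (hd i).ne'
  constructor
  · have := (hτ i).pos (div_pos hS0 (hd i))
    simp only [heq] at this
    exact_mod_cast this.trans_le hle
  · refine (ciInf_le (Set.finite_range _).bddBelow i).trans ?_
    rwa [heq]

theorem nestedBound_lowerBound_of_finite
    (hσ : ∀ i, IsRankExpansionLowerBound (σ i) (A i))
    (hd : ∀ i, 0 < d i) (hps : ∀ i, pseudoinverse (σ i) 1 = ENNReal.ofReal (d i))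
    (hτ : ∀ i, IsNormalizedGrowth fun x => σ i (d i * x)) :
    IsRankExpansionLowerBound (nestedBound σ) (piKronecker A) ∧
      ConcaveOn ℝ (Set.Ici 0) (nestedBound σ) ∧ LogLogConcave (nestedBound σ) := by
  have hD : 0 < ∏ i, d i := Finset.prod_pos fun i _ => hd i
  have hT := IsNormalizedGrowth.ciInf hτ
  have hB := hT.isRankExpansionLowerBound hD (hasColumnGrowth_piKronecker hσ hd hτ)
  have heq : ∀ x, 0 ≤ x → nestedBound σ x = ⨅ j, σ j (d j * (x / ∏ i, d i)) :=
    fun x hx => nestedBound_eq hd hps hx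
  refine ⟨⟨hB.continuousOn.congr heq, fun x hx => ?_,
    hB.monotoneOn.congr fun x hx => (heq x hx).symm,
    fun k hk hkn => ?_⟩, ?_, ?_⟩
  · rw [heq x hx]
    exact hB.nonneg x hx
  · rw [heq k k.cast_nonneg]
    exact hB.le_rankExpansion k hk hkn
  · refine (concaveOn_comp_const_mul hT.concaveOn (inv_nonneg.2 hD.le)).congr fun x hx => ?_
    rw [heq x hx]
    simp only [div_eq_inv_mul]
  · refine (hT.logLogConcave.comp_const_mul (inv_pos.2 hD)).congr fun x hx => ?_
    rw [heq x hx.le]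
    simp only [div_eq_inv_mul]

/-- Ranks of nonempty sets of columns of the product are at least `1`, so a lower bound may exceed
the nested bound as long as it stays below `1` there. -/
theorem isRankExpansionLowerBound_of_le_max_nestedBound
    (hσ : ∀ i, IsRankExpansionLowerBound (σ i) (A i))
    (hd : ∀ i, 0 < d i) (hps : ∀ i, pseudoinverse (σ i) 1 = ENNReal.ofReal (d i))
    (hτ : ∀ i, IsNormalizedGrowth fun x => σ i (d i * x)) {f : ℝ → ℝ}
    (hfc : ContinuousOn f (Set.Ici 0)) (hfm : MonotoneOn f (Set.Ici 0)) (hf0 : 0 ≤ f 0)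
    (hf : ∀ x, 0 ≤ x → f x ≤ max (nestedBound σ x) 1) :
    IsRankExpansionLowerBound f (piKronecker A) where
  continuousOn := hfc
  nonneg x hx := hf0.trans (hfm (by simp) hx hx)
  monotoneOn := hfm
  le_rankExpansion := (le_rankExpansion_iff _ _).2 fun S hS => by
    obtain ⟨h1, h2⟩ := hasColumnGrowth_piKronecker hσ hd hτ S hS
    refine (hf _ (Nat.cast_nonneg _)).trans (max_le ?_ (by exact_mod_cast h1))
    rwa [nestedBound_eq hd hps (Nat.cast_nonneg _)]

end Product

/-! ### Powers -/

section Power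

theorem logLogConcave_rpow (q : ℝ) : LogLogConcave fun x => x ^ q := by
  rw [logLogConcave_iff fun x hx => Real.rpow_pos_of_pos hx q]
  have : (fun u => Real.log (Real.exp u ^ q)) = fun u => q * u := by
    funext u
    rw [Real.log_rpow (Real.exp_pos u), Real.log_exp]
  rw [this]
  exact (LinearMap.mulLeft ℝ q).concaveOn convex_univ

theorem isNormalizedGrowth_rpow {q : ℝ} (hq : 0 < q) (hq1 : q ≤ 1) :
    IsNormalizedGrowth fun x => x ^ q where
  continuousOn := (Real.continuous_rpow_const hq.le).continuousOn
  monotoneOn := Real.monotoneOn_rpow_Ici_of_exponent_nonneg hq.le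
  concaveOn := Real.concaveOn_rpow hq.le hq1
  logLogConcave := logLogConcave_rpow q
  map_zero := Real.zero_rpow hq.ne'
  map_one := Real.one_rpow q

end Power

/-! ### Logarithms -/

section Logarithm

theorem concaveOn_log_add_one : ConcaveOn ℝ (Set.Ici 0) fun x => Real.log (x + 1) := by
  have := strictConcaveOn_log_Ioi.concaveOn.translate_left 1
  exact this.subset (fun x (hx : 0 ≤ x) => show (0 : ℝ) < 1 + x by linarith) (convex_Ici 0)

theorem logLogConcave_log_add_one : LogLogConcave fun x => Real.log (x + 1) := by
  rw [logLogConcave_iff fun x hx => Real.log_pos (by linarith)]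
  have hpos : ∀ u, 0 < Real.log (Real.exp u + 1) := fun u =>
    Real.log_pos (by linarith [Real.exp_pos u])
  have hder : ∀ u, HasDerivAt (fun u => Real.log (Real.log (Real.exp u + 1)))
      (Real.exp u / (Real.exp u + 1) / Real.log (Real.exp u + 1)) u := fun u => by
    have h1 : HasDerivAt (fun u => Real.exp u + 1) (Real.exp u) u :=
      (Real.hasDerivAt_exp u).add_const 1
    exact (h1.log (by positivity)).log (hpos u).ne'
  refine Antitone.concaveOn_univ_of_deriv (fun u => (hder u).differentiableAt) ?_
  intro u v huv
  rw [(hder u).deriv, (hder v).deriv]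
  have hu := Real.exp_pos u
  have hv := Real.exp_pos v
  -- the reciprocal of the derivative is the slope at `1` of the convex function `x * log x`
  have hs := Real.convexOn_mul_log.secant_mono (a := 1) (x := Real.exp u + 1)
    (y := Real.exp v + 1) (by simp) (Set.mem_Ici.2 (by positivity)) (Set.mem_Ici.2 (by positivity))
    (by linarith) (by linarith) (by gcongr)
  simp only [Real.log_one, mul_zero, sub_zero, add_sub_cancel_right] at hs
  have := hpos u
  have := hpos v
  have h1 : ∀ w, Real.exp w / (Real.exp w + 1) / Real.log (Real.exp w + 1) =
      ((Real.exp w + 1) * Real.log (Real.exp w + 1) / Real.exp w)⁻¹ := fun w => by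
    rw [inv_div, div_div]
  rw [h1, h1]
  exact inv_anti₀ (by positivity) hs

theorem mul_log_exp_one_div {a : ℝ} (ha : 0 < a) : a * Real.log (Real.exp (1 / a) - 1 + 1) = 1 := by
  rw [sub_add_cancel, Real.log_exp, mul_one_div_cancel ha.ne']

theorem exp_one_div_sub_one_pos {a : ℝ} (ha : 0 < a) : 0 < Real.exp (1 / a) - 1 := by
  have : 0 < 1 / a := by positivity
  linarith [Real.add_one_lt_exp this.ne']

/-- `a ln(bx + 1)` takes the value `1` at `b⁻¹ (e^{1/a} - 1)`; scaling by this point leaves a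
function that depends on `a` only. -/
theorem isNormalizedGrowth_log {a : ℝ} (ha : 0 < a) :
    IsNormalizedGrowth fun x => a * Real.log ((Real.exp (1 / a) - 1) * x + 1) := by
  have hB := exp_one_div_sub_one_pos ha
  have hm : MonotoneOn (fun x => a * Real.log ((Real.exp (1 / a) - 1) * x + 1)) (Set.Ici 0) := by
    intro x hx y hy hxy
    have h0 := mul_nonneg hB.le (Set.mem_Ici.1 hx)
    refine mul_le_mul_of_nonneg_left (Real.log_le_log (by linarith) ?_) ha.le
    gcongr
  refine ⟨?_, hm, ?_, ?_, by simp, by rw [mul_one, mul_log_exp_one_div ha]⟩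
  · refine ContinuousOn.mul continuousOn_const (ContinuousOn.log (by fun_prop) fun x hx => ?_)
    have h0 := mul_nonneg hB.le (Set.mem_Ici.1 hx)
    linarith
  · exact (concaveOn_comp_const_mul concaveOn_log_add_one hB.le).smul ha.le
  · exact (logLogConcave_log_add_one.comp_const_mul hB).const_mul ha

/-- For arguments `y ≥ 1` the normalized logarithmic functions increase with `a`, so that the
smallest `a` gives the minimum. Exponentiated, this is an instance of the convexity of
`x ↦ x ^ r` for `r ≥ 1`. -/
theorem monotoneOn_mul_log_exp_one_div {y : ℝ} (hy : 1 ≤ y) :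
    MonotoneOn (fun a => a * Real.log ((Real.exp (1 / a) - 1) * y + 1)) (Set.Ioi 0) := by
  intro a ha b hb hab
  have ha : 0 < a := ha
  have hb : 0 < b := hb
  have hy0 : 0 < y := by linarith
  set E := Real.exp (1 / b) with hE
  have hE1 : 0 < E - 1 := exp_one_div_sub_one_pos hb
  set W := (E - 1) * y + 1 with hW
  have hW0 : 0 < W := by positivity
  have hr : 1 ≤ b / a := (one_le_div ha).2 hab
  have hEr : Real.exp (1 / a) = E ^ (b / a) := by
    rw [hE, ← Real.exp_mul]
    congr 1
    field_simp
  -- `E` is the convex combination `W / y + (1 - 1 / y)`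
  have hconv := (convexOn_rpow hr).2 (Set.mem_Ici.2 hW0.le) (Set.mem_Ici.2 zero_le_one)
    (show 0 ≤ 1 / y by positivity) (show 0 ≤ 1 - 1 / y by
      rw [sub_nonneg, div_le_one hy0]; exact hy) (by ring)
  have hcomb : (1 / y) • W + (1 - 1 / y) • (1 : ℝ) = E := by
    simp only [smul_eq_mul, hW]
    field_simp
    ring
  rw [hcomb] at hconv
  simp only [smul_eq_mul, mul_one, Real.one_rpow, ← hEr] at hconv
  have hle : (Real.exp (1 / a) - 1) * y + 1 ≤ W ^ (b / a) := by
    have := mul_le_mul_of_nonneg_right hconv hy0.le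
    have h2 : (1 / y * W ^ (b / a) + (1 - 1 / y)) * y = W ^ (b / a) + (y - 1) := by
      field_simp
    linarith
  have hlog := Real.log_le_log (by have := exp_one_div_sub_one_pos ha; positivity) hle
  rw [Real.log_rpow hW0] at hlog
  calc a * Real.log ((Real.exp (1 / a) - 1) * y + 1) ≤ a * (b / a * Real.log W) := by gcongr
    _ = b * Real.log W := by field_simp

end Logarithm

/-! ### The bounds for general and parametrized functions -/

section Assembly

variable {𝕜 : Type*} [Field 𝕜] {p : ℕ} {m n : Fin p → ℕ}
  {A : ∀ i, Matrix (Fin (m i)) (Fin (n i)) 𝕜}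

theorem nestedBound_lowerBound [Nontrivial (Fin p)] {σ : Fin p → ℝ → ℝ}
    (hσ : ∀ i, IsRankExpansionLowerBound (σ i) (A i))
    (hc : ∀ i, ConcaveOn ℝ (Set.Ici 0) (σ i)) (hl : ∀ i, LogLogConcave (σ i))
    (h0 : ∀ i, σ i 0 = 0) :
    IsRankExpansionLowerBound (nestedBound σ) (piKronecker A) ∧
      ConcaveOn ℝ (Set.Ici 0) (nestedBound σ) ∧ LogLogConcave (nestedBound σ) := by
  by_cases htop : ∃ i, pseudoinverse (σ i) 1 = ⊤
  · obtain ⟨i, hi⟩ := htop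
    have hz : nestedBound σ = fun _ => 0 := funext fun x =>
      nestedBound_eq_zero (fun i x hx => (hσ i).nonneg x hx) h0
        (fun i => pseudoinverse_one_ne_zero (hσ i).continuousOn (h0 i)) hi x
    rw [hz]
    refine ⟨⟨continuousOn_const, fun _ _ => le_rfl, fun _ _ _ _ _ => le_rfl,
      fun k _ _ => Nat.cast_nonneg _⟩, concaveOn_const _ (convex_Ici 0), ?_⟩
    simpa [LogLogConcave] using concaveOn_const (0 : ℝ) (convex_empty (𝕜 := ℝ) (E := ℝ))
  · push Not at htop
    choose d hd h1 hps using fun i =>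
      exists_pseudoinverse_one_eq (hσ i).continuousOn (hσ i).monotoneOn (h0 i) (htop i)
    exact nestedBound_lowerBound_of_finite hσ hd hps fun i =>
      isNormalizedGrowth_comp_const_mul (hσ i) (hc i) (hl i) (h0 i) (hd i) (h1 i)

/-- Lower bounds drawn, up to scaling, from a one-parameter family of normalized growth functions
that increases with its parameter on `[1, ∞)`: the nested bound agrees from the product of the
scales on with the member for the smallest parameter, and below that point this member is at
most `1`, so that it is a lower bound everywhere. -/
theorem rankExpansion_bound_of_family [Nonempty (Fin p)] {g : ℝ → ℝ → ℝ} {s : Set ℝ}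
    (hg : ∀ c ∈ s, IsNormalizedGrowth (g c))
    (hmono : ∀ y, 1 ≤ y → MonotoneOn (fun c => g c y) s)
    (hgt : ∀ c ∈ s, ∀ y, 1 < y → 1 < g c y)
    {c d : Fin p → ℝ} (hc : ∀ i, c i ∈ s) (hd : ∀ i, 0 < d i)
    {σ : Fin p → ℝ → ℝ} (hσg : ∀ i x, σ i x = g (c i) (x / d i)) {σC : ℝ → ℝ}
    (hσC : ∀ x, σC x = g (⨅ i, c i) (x / ∏ i, d i))
    (hσ : ∀ i, IsRankExpansionLowerBound (σ i) (A i)) :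
    IsRankExpansionLowerBound σC (piKronecker A) ∧ ConcaveOn ℝ (Set.Ici 0) σC ∧
      LogLogConcave σC ∧ ∀ x, ∏ i, d i ≤ x → nestedBound σ x = σC x := by
  have hD : 0 < ∏ i, d i := Finset.prod_pos fun i _ => hd i
  have hcs : ⨅ i, c i ∈ s := by
    obtain ⟨j, hj⟩ := exists_eq_ciInf_of_finite (f := c)
    exact hj ▸ hc j
  have hG := hg _ hcs
  have hscale : ∀ i x, σ i (d i * x) = g (c i) x := fun i x => by
    rw [hσg, mul_div_cancel_left₀ _ (hd i).ne']
  have hτ : ∀ i, IsNormalizedGrowth fun x => σ i (d i * x) := fun i => by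
    simpa only [hscale] using hg _ (hc i)
  have hps : ∀ i, pseudoinverse (σ i) 1 = ENNReal.ofReal (d i) := fun i => by
    refine pseudoinverse_one_eq (hd i) ?_ fun x hx => ?_
    · rw [hσg, div_self (hd i).ne', (hg _ (hc i)).map_one]
    · rw [hσg]
      exact hgt _ (hc i) _ ((one_lt_div (hd i)).2 hx)
  have heq : ∀ x, ∏ i, d i ≤ x → nestedBound σ x = σC x := fun x hx => by
    rw [nestedBound_eq hd hps (hD.le.trans hx), hσC]
    simp only [hscale]
    exact (map_ciInf_of_monotoneOn (hmono _ ((one_le_div hD).2 hx)) hc).symm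
  have hσC' : σC = fun x => g (⨅ i, c i) ((∏ i, d i)⁻¹ * x) := funext fun x => by
    rw [hσC, div_eq_inv_mul]
  have hmap : ∀ x : ℝ, 0 ≤ x → 0 ≤ (∏ i, d i)⁻¹ * x := fun x hx => by positivity
  refine ⟨isRankExpansionLowerBound_of_le_max_nestedBound hσ hd hps hτ ?_ ?_ ?_ fun x hx => ?_,
    ?_, ?_, heq⟩
  · rw [hσC']
    exact hG.continuousOn.comp (by fun_prop) fun x hx => hmap x hx
  · rw [hσC']
    exact fun x hx y hy hxy => hG.monotoneOn (hmap x hx) (hmap y hy) (by gcongr)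
  · rw [hσC, zero_div, hG.map_zero]
  · rcases le_total (∏ i, d i) x with h | h
    · exact (heq x h).ge.trans (le_max_left _ _)
    · refine le_trans ?_ (le_max_right _ _)
      rw [hσC, ← hG.map_one]
      exact hG.monotoneOn (div_nonneg hx hD.le) (Set.mem_Ici.2 zero_le_one) ((div_le_one hD).2 h)
  · rw [hσC']
    exact concaveOn_comp_const_mul hG.concaveOn (inv_nonneg.2 hD.le)
  · rw [hσC']
    exact hG.logLogConcave.comp_const_mul (inv_pos.2 hD)

end Assembly

theorem theorem2 {𝕜 : Type*} [RCLike 𝕜] {p : ℕ} (hp : 2 ≤ p) (m n : Fin p → ℕ)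
    (A : ∀ i, Matrix (Fin (m i)) (Fin (n i)) 𝕜) :
    -- the general bound
    (∀ σ : Fin p → ℝ → ℝ,
      (∀ i, IsRankExpansionLowerBound (σ i) (A i)) →
      (∀ i, ConcaveOn ℝ (Set.Ici 0) (σ i)) →
      (∀ i, LogLogConcave (σ i)) →
      (∀ i, σ i 0 = 0) →
        IsRankExpansionLowerBound (nestedBound σ) (piKronecker A) ∧
        ConcaveOn ℝ (Set.Ici 0) (nestedBound σ) ∧
        LogLogConcave (nestedBound σ)) ∧
    -- monomials
    (∀ (κ q : Fin p → ℝ) (σ : Fin p → ℝ → ℝ) (σC : ℝ → ℝ),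
      (∀ i, 1 ≤ κ i) →
      (∀ i, 0 < q i ∧ q i ≤ 1) →
      (∀ i x, σ i x = (x / κ i) ^ q i) →
      (∀ x, σC x = (x / ∏ i, κ i) ^ (⨅ i, q i)) →
      (∀ i, IsRankExpansionLowerBound (σ i) (A i)) →
        IsRankExpansionLowerBound σC (piKronecker A) ∧
        ConcaveOn ℝ (Set.Ici 0) σC ∧
        LogLogConcave σC ∧
        ∀ x, ∏ i, κ i ≤ x → nestedBound σ x = σC x) ∧
    -- logarithms
    (∀ (a b : Fin p → ℝ) (σ : Fin p → ℝ → ℝ) (a' b' : ℝ) (σC : ℝ → ℝ),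
      (∀ i, 0 < a i) →
      (∀ i, 0 < b i) →
      (∀ i x, σ i x = a i * Real.log (b i * x + 1)) →
      a' = ⨅ i, a i →
      b' = (Real.exp (1 / a') - 1) / ∏ i, ((b i)⁻¹ * (Real.exp (1 / a i) - 1)) →
      (∀ x, σC x = a' * Real.log (b' * x + 1)) →
      (∀ i, IsRankExpansionLowerBound (σ i) (A i)) →
        IsRankExpansionLowerBound σC (piKronecker A) ∧
        ConcaveOn ℝ (Set.Ici 0) σC ∧
        LogLogConcave σC ∧
        ∀ x, ∏ i, ((b i)⁻¹ * (Real.exp (1 / a i) - 1)) ≤ x → nestedBound σ x = σC x) := by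
  have hnt : Nontrivial (Fin p) := Fin.nontrivial_iff_two_le.2 hp
  have hne : Nonempty (Fin p) := hnt.to_nonempty
  refine ⟨fun σ hσ hc hl h0 => nestedBound_lowerBound hσ hc hl h0, ?_, ?_⟩
  · intro κ q σ σC hκ hq hσq hσC hσ
    refine rankExpansion_bound_of_family (g := fun q x => x ^ q) (s := Set.Ioc 0 1)
      (fun q hq => isNormalizedGrowth_rpow hq.1 hq.2)
      (fun y hy q _ r _ hqr => Real.rpow_le_rpow_of_exponent_le hy hqr)
      (fun q hq y hy => Real.one_lt_rpow hy hq.1) hq (fun i => by linarith [hκ i]) hσq hσC hσ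
  · intro a b σ a' b' σC ha hb hσa ha' hb' hσC hσ
    refine rankExpansion_bound_of_family
      (g := fun a x => a * Real.log ((Real.exp (1 / a) - 1) * x + 1)) (s := Set.Ioi 0)
      (fun a ha => isNormalizedGrowth_log ha) (fun y hy => monotoneOn_mul_log_exp_one_div hy)
      (fun a ha y hy => ?_) (c := a) ha
      (fun i => mul_pos (inv_pos.2 (hb i)) (exp_one_div_sub_one_pos (ha i)))
      (fun i x => ?_) (fun x => ?_) hσ
    · have ha : 0 < a := ha
      have hB := exp_one_div_sub_one_pos ha
      calc (1 : ℝ) = a * Real.log ((Real.exp (1 / a) - 1) * 1 + 1) := by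
            rw [mul_one, mul_log_exp_one_div ha]
        _ < _ := by gcongr
    · rw [hσa]
      have := (hb i).ne'
      have := (exp_one_div_sub_one_pos (ha i)).ne'
      congr 3
      field_simp
    · rw [hσC, hb', ha']
      congr 3
      ring
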